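/- Throughout, a rational polyhedral fan in $\mathbb{R}^n$ is a finite collection $\mathcal F$ of convex cones, each generated by finitely many vectors of $\mathbb{Z}^n$ (cones may contain lines), such that every face of a cone of $\mathcal F$ lies in $\mathcal F$ and the intersection of any two cones of $\mathcal F$ is a face of both. A facet of $\mathcal F$ is an inclusion-maximal cone. For a finite collection of cones, its dimension is the maximum of the dimensions of its cones, its codimension is $n$ minus its dimension, and its support is the union of its cones. The fan $\mathcal F$ is pure if all its facets have the same dimension, and weighted if each facet $\sigma$ carries a real weight $w(\sigma)$. A pure weighted fan $\mathcal F$ is balanced if for every $\tau\in\mathcal F$ with $\dim\tau=\dim\mathcal F-1$, $$\sum_{\sigma\supseteq\tau\text{ facet}} w(\sigma)\,v_{\sigma/\tau}\in\operatorname{span}(\tau),$$ where $v_{\sigma/\tau}\in\sigma\cap\mathbb{Z}^n$ is a vector whose class generates $(\mathbb{Z}^n\cap\operatorname{span}\sigma)/(\mathbb{Z}^n\cap\operatorname{span}\tau)$ (it is unique modulo $\operatorname{span}\tau$). The common refinement of $\mathcal F_1,\dots,\mathcal F_k$ is $\mathcal F_1\wedge\cdots\wedge\mathcal F_k=\{\sigma_1\cap\cdots\cap\sigma_k:\sigma_i\in\mathcal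 F_i\}$. For a collection $\mathcal G$ of cones and $\omega$ in its support, $\operatorname{link}_\omega(\mathcal G)$ is the collection of the cones $\{u\in\mathbb{R}^n:\exists\,\delta>0\ \forall\,\varepsilon\in(0,\delta):\ \omega+\varepsilon u\in\sigma\}$ for all $\sigma\in\mathcal G$ with $\omega\in\sigma$. **Corollary.** Let $\mathcal F_1,\dots,\mathcal F_k$ be pure balanced rational polyhedral fans in $\mathbb{R}^n$ all of whose facets have positive weight, and let $\omega\in\operatorname{supp}(\mathcal F_1\wedge\cdots\wedge\mathcal F_k)$. Then $$\dim\bigl(\operatorname{link}_\omega(\mathcal F_1\wedge\cdots\wedge\mathcal F_k)\bigr)\ \ge\ n-\sum_{i=1}^k\operatorname{codim}(\mathcal F_i).$$ -/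

import Mathlib

namespace TropFan

noncomputable section

/-- A convex cone in `ℝⁿ` containing the origin; it may contain lines. -/
abbrev Cone (n : ℕ) := PointedCone ℝ (Fin n → ℝ)

/-- The real vector with the given integer coordinates. -/
def intVec {n : ℕ} (z : Fin n → ℤ) : Fin n → ℝ := fun i => (z i : ℝ)

/-- The linear span of a cone. -/
def linSpan {n : ℕ} (σ : Cone n) : Submodule ℝ (Fin n → ℝ) :=
  Submodule.span ℝ (σ : Set (Fin n → ℝ))

/-- The dimension of a cone. -/
def coneDim {n : ℕ} (σ : Cone n) : ℕ := Module.finrank ℝ (linSpan σ)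

/-- Rational polyhedral cones: those generated by finitely many integer vectors. -/
def IsRational {n : ℕ} (σ : Cone n) : Prop :=
  ∃ S : Finset (Fin n → ℤ), σ = PointedCone.hull ℝ (intVec '' (S : Set (Fin n → ℤ)))

/-- The dimension of a collection of cones in `ℝⁿ`: the largest dimension of its members
(all dimensions are at most `n`; the empty collection gets `0`). -/
def dim {n : ℕ} (F : Set (Cone n)) : ℕ := sSup (coneDim '' F)

/-- The codimension in `ℝⁿ` of a collection of cones. -/
def codim {n : ℕ} (F : Set (Cone n)) : ℤ := (n : ℤ) - (dim F : ℤ)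

/-- The support of a collection of cones: the union of its members. -/
def support {n : ℕ} (F : Set (Cone n)) : Set (Fin n → ℝ) := {x | ∃ σ ∈ F, x ∈ σ}

/-- The common refinement `F₁ ∧ ⋯ ∧ F_k`: all intersections `σ₁ ∩ ⋯ ∩ σ_k` with `σᵢ ∈ Fᵢ`. -/
def commonRefinement {n k : ℕ} (F : Fin k → Set (Cone n)) : Set (Cone n) :=
  {C | ∃ σ : Fin k → Cone n, (∀ i, σ i ∈ F i) ∧ C = ⨅ i, σ i}

/-- The link of a cone `σ` at a point `ω ∈ σ`: the directions in which one can move from `ω` a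
small positive distance without leaving `σ`. -/
def linkCone {n : ℕ} (ω : Fin n → ℝ) (σ : Cone n) (hω : ω ∈ σ) : Cone n where
  carrier := {u | ∃ δ : ℝ, 0 < δ ∧ ∀ ε : ℝ, 0 < ε → ε < δ → ω + ε • u ∈ σ}
  zero_mem' := ⟨1, one_pos, fun ε _ _ => by simpa using hω⟩
  add_mem' := by
    rintro u v ⟨δ, hδ, hu⟩ ⟨δ', hδ', hv⟩
    refine ⟨min δ δ' / 2, by positivity, fun ε hε hlt => ?_⟩
    have h1 : 2 * ε < δ := by linarith [min_le_left δ δ']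
    have h2 : 2 * ε < δ' := by linarith [min_le_right δ δ']
    have key := σ.convex (hu (2 * ε) (by linarith) h1) (hv (2 * ε) (by linarith) h2)
      (show (0 : ℝ) ≤ 1 / 2 by norm_num) (show (0 : ℝ) ≤ 1 / 2 by norm_num) (by norm_num)
    have e : ω + ε • (u + v)
        = (1 / 2 : ℝ) • (ω + (2 * ε) • u) + (1 / 2 : ℝ) • (ω + (2 * ε) • v) := by
      module
    rw [e]
    exact key
  smul_mem' := by
    rintro ⟨c, hc⟩ u ⟨δ, hδ, hu⟩
    rcases hc.eq_or_lt with h0 | hpos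
    · refine ⟨1, one_pos, fun ε _ _ => ?_⟩
      subst h0
      simpa [Subtype.ext_iff, Nonneg.mk_smul] using hω
    · refine ⟨δ / c, by positivity, fun ε hε hlt => ?_⟩
      have := hu (ε * c) (by positivity) ((lt_div_iff₀ hpos).1 hlt)
      rw [Nonneg.mk_smul, smul_smul]
      exact this

/-- The link of a collection of cones at `ω`: the links at `ω` of those members that
contain `ω`. -/
def link {n : ℕ} (ω : Fin n → ℝ) (F : Set (Cone n)) : Set (Cone n) :=
  {C | ∃ σ ∈ F, ∃ hω : ω ∈ σ, C = linkCone ω σ hω}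

/-- A rational polyhedral fan in `ℝⁿ`. -/
structure Fan (n : ℕ) where
  cones : Finset (Cone n)
  rational : ∀ σ ∈ cones, IsRational σ
  face_mem : ∀ σ ∈ cones, ∀ τ : Cone n, τ.IsFaceOf σ → τ ∈ cones
  inter_face : ∀ σ ∈ cones, ∀ τ ∈ cones, (σ ⊓ τ).IsFaceOf σ ∧ (σ ⊓ τ).IsFaceOf τ

/-- A facet of a fan: an inclusion-maximal cone. -/
def Fan.IsFacet {n : ℕ} (F : Fan n) (σ : Cone n) : Prop := Maximal (· ∈ F.cones) σ

/-- A fan is pure if all its facets have the same dimension, that of the fan. -/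
def Fan.IsPure {n : ℕ} (F : Fan n) : Prop :=
  ∀ σ, F.IsFacet σ → coneDim σ = dim (F.cones : Set (Cone n))

/-- A weighted fan: a rational fan with a real weight on each facet (the values of `weight`
at other cones are never used). -/
structure WeightedFan (n : ℕ) extends Fan n where
  weight : Cone n → ℝ

/-- All facets have positive weight. -/
def WeightedFan.PositiveWeights {n : ℕ} (F : WeightedFan n) : Prop :=
  ∀ σ, F.IsFacet σ → 0 < F.weight σ

/-- `v` is an integer vector of `σ` whose class generates the rank one lattice
`(ℤⁿ ∩ span σ) / (ℤⁿ ∩ span τ)`, where `τ` is a face of `σ` of codimension one. Such a `v` always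
exists for rational cones, and it is unique modulo `span τ`. -/
def IsPrimitiveGenerator {n : ℕ} (τ σ : Cone n) (v : Fin n → ℤ) : Prop :=
  intVec v ∈ σ ∧ ∀ z : Fin n → ℤ, intVec z ∈ linSpan σ →
    ∃ m : ℤ, intVec (z - m • v) ∈ linSpan τ

open Classical in
/-- The balancing condition on a (pure) weighted fan: at each cone `τ` of codimension one in the
fan, the sum of the primitive generators `v_{σ/τ}` over all facets `σ ⊇ τ`, multiplied with
the weights of the facets, lies in `span τ`. As the generators exist and are unique modulo `span τ`,
it does not matter which representatives are chosen. -/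
def WeightedFan.IsBalanced {n : ℕ} (F : WeightedFan n) : Prop :=
  ∀ τ ∈ F.cones, coneDim τ + 1 = dim (F.cones : Set (Cone n)) →
    ∃ v : Cone n → (Fin n → ℤ),
      (∀ σ, F.IsFacet σ → τ ≤ σ → IsPrimitiveGenerator τ σ (v σ)) ∧
      ∑ σ ∈ F.cones.filter (fun σ => F.IsFacet σ ∧ τ ≤ σ), F.weight σ • intVec (v σ) ∈ linSpan τ

end

end TropFan

/-! Replace the fans by their product, in which the intersection of the supports appears as the
section by the diagonal. The point is a lower bound for the local dimension of any linear section
of a `d`-dimensional positively balanced fan.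

If a subspace `L` of dimension one more than complementary to the fan is translated to general
position, its section of the fan is one-dimensional, and balancing says that no linear form is
negative on all the edges at a vertex. Hence a Euclidean norm, being strictly convex, has no local
maximum on the section, which therefore leaves every ball it meets. By compactness the section by
`ω + L` cannot be reduced to the point `ω` near `ω` either: otherwise nearby translates would have
sections trapped in a small ball around `ω`. So an affine subspace that meets the fan near `ω` only
at `ω` has at most complementary dimension, and this applies to the image of a subspace in general
position with respect to the preimages of the cones. -/

open Module Filter Topology

namespace TropFan

section ClosedCones

variable {V ι : Type*} [AddCommGroup V] [Module ℝ V] {v : ι → V} {s : Finset ι}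

theorem mem_hull_image_finset {x : V} :
    x ∈ PointedCone.hull ℝ (v '' s) ↔ ∃ c : ι → ℝ, (∀ i ∈ s, 0 ≤ c i) ∧ ∑ i ∈ s, c i • v i = x := by
  constructor
  · intro hx
    obtain ⟨c, hcs, rfl⟩ := (Finsupp.mem_span_image_iff_linearCombination _).1 hx
    refine ⟨fun i => c i, fun i _ => (c i).2, ?_⟩
    rw [Finsupp.linearCombination_apply, Finsupp.sum_of_support_subset c hcs _ (by simp)]
    rfl
  · rintro ⟨c, hc, rfl⟩
    exact Submodule.sum_mem _ fun i hi =>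
      PointedCone.smul_mem _ (hc i hi) (Submodule.subset_span ⟨i, hi, rfl⟩)

theorem exists_pos_sum_smul_eq_zero (hv : ¬ LinearIndepOn ℝ v (s : Set ι)) :
    ∃ g : ι → ℝ, ∑ i ∈ s, g i • v i = 0 ∧ ∃ i ∈ s, 0 < g i := by
  obtain ⟨g, hg, i, hi, hi0⟩ := not_linearIndepOn_finset_iff.1 hv
  rcases hi0.lt_or_gt with hneg | hpos
  · exact ⟨-g, by simp [hg], i, hi, neg_pos.2 hneg⟩
  · exact ⟨g, hg, i, hi, hpos⟩

theorem exists_mem_hull_image_erase [DecidableEq ι] (hv : ¬ LinearIndepOn ℝ v (s : Set ι)) {x : V}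
    (hx : x ∈ PointedCone.hull ℝ (v '' s)) :
    ∃ i ∈ s, x ∈ PointedCone.hull ℝ (v '' (s.erase i : Finset ι)) := by
  obtain ⟨g, hg, i₁, hi₁, hpos⟩ := exists_pos_sum_smul_eq_zero hv
  obtain ⟨c, hc, rfl⟩ := mem_hull_image_finset.1 hx
  -- The largest multiple of the relation `g` that can be subtracted from `c` makes one coefficient
  -- vanish.
  obtain ⟨i₀, hi₀, hmin⟩ := (s.filter fun i => 0 < g i).exists_min_image (fun i => c i / g i)
    ⟨i₁, Finset.mem_filter.2 ⟨hi₁, hpos⟩⟩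
  obtain ⟨hi₀s, hg₀⟩ := Finset.mem_filter.1 hi₀
  set a := c i₀ / g i₀ with ha
  have ha0 : 0 ≤ a := div_nonneg (hc i₀ hi₀s) hg₀.le
  have hnonneg : ∀ i ∈ s, 0 ≤ c i - a * g i := by
    intro i hi
    rcases le_or_gt (g i) 0 with hgi | hgi
    · exact sub_nonneg.2 ((mul_nonpos_of_nonneg_of_nonpos ha0 hgi).trans (hc i hi))
    · exact sub_nonneg.2 ((le_div_iff₀ hgi).1 (hmin i (Finset.mem_filter.2 ⟨hi, hgi⟩)))
  have hsum : ∑ i ∈ s, (c i - a * g i) • v i = ∑ i ∈ s, c i • v i := by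
    simp only [sub_smul, mul_smul, Finset.sum_sub_distrib, ← Finset.smul_sum, hg, smul_zero,
      sub_zero]
  have hzero : c i₀ - a * g i₀ = 0 := by rw [ha, div_mul_cancel₀ _ hg₀.ne', sub_self]
  refine ⟨i₀, hi₀s, mem_hull_image_finset.2
    ⟨_, fun i hi => hnonneg i (Finset.mem_of_mem_erase hi), ?_⟩⟩
  rw [← hsum, ← Finset.add_sum_erase s _ hi₀s, hzero, zero_smul, zero_add]

variable [TopologicalSpace V] [IsTopologicalAddGroup V] [ContinuousSMul ℝ V] [T2Space V]

theorem isClosed_hull_image_of_linearIndepOn (hv : LinearIndepOn ℝ v (s : Set ι)) :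
    IsClosed (PointedCone.hull ℝ (v '' s) : Set V) := by
  have hemb := LinearMap.isClosedEmbedding_of_injective
    (LinearMap.ker_eq_bot.2 (LinearIndependent.fintypeLinearCombination_injective hv))
  convert hemb.isClosedMap _ (isClosed_Ici (a := 0))
  ext x
  rw [SetLike.mem_coe, PointedCone.hull, Submodule.mem_span_image_finset_iff_exists_fun]
  exact ⟨fun ⟨c, hc⟩ => ⟨fun i => c i, fun i => (c i).2, hc⟩,
    fun ⟨c, hc, hx⟩ => ⟨fun i => ⟨c i, hc i⟩, hx⟩⟩

theorem isClosed_hull_image_finset (v : ι → V) (s : Finset ι) :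
    IsClosed (PointedCone.hull ℝ (v '' s) : Set V) := by
  classical
  induction s using Finset.strongInduction with
  | H s ih =>
    by_cases hv : LinearIndepOn ℝ v (s : Set ι)
    · exact isClosed_hull_image_of_linearIndepOn hv
    · have hunion : (PointedCone.hull ℝ (v '' s) : Set V) =
          ⋃ i ∈ s, PointedCone.hull ℝ (v '' (s.erase i : Finset ι)) := by
        refine subset_antisymm (fun x hx => ?_) (Set.iUnion₂_subset fun i _ => ?_)
        · simpa only [Set.mem_iUnion₂, exists_prop, SetLike.mem_coe] using
            exists_mem_hull_image_erase hv hx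
        · exact Submodule.span_mono (Set.image_mono (Finset.coe_subset.2 (s.erase_subset i)))
      rw [hunion]
      exact s.finite_toSet.isClosed_biUnion fun i hi => ih _ (Finset.erase_ssubset hi)

end ClosedCones

section Subspaces

variable {K V : Type*} [DivisionRing K] [Infinite K] [AddCommGroup V] [Module K V] {ι : Type*}
  {s : Set ι}

theorem exists_mem_forall_notMem (hs : s.Finite) {D : Submodule K V} {B : ι → Submodule K V}
    (h : ∀ i ∈ s, ¬ D ≤ B i) : ∃ u ∈ D, ∀ i ∈ s, u ∉ B i := by
  have : Finite s := hs
  by_contra! hcover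
  obtain ⟨i, hi⟩ := Subspace.exists_eq_top_of_iUnion_eq_univ
    (p := fun i : s => (B i).comap D.subtype) (Set.eq_univ_of_forall fun u => by
      obtain ⟨i, hi, hu⟩ := hcover u u.2
      exact Set.mem_iUnion.2 ⟨⟨i, hi⟩, hu⟩)
  exact h i i.2 (Submodule.comap_subtype_eq_top.1 hi)

theorem exists_le_disjoint_le_sup [FiniteDimensional K V] (hs : s.Finite) (hne : s.Nonempty)
    (W : ι → Submodule K V) (D : Submodule K V) :
    ∃ M ≤ D, (∀ i ∈ s, Disjoint M (W i)) ∧ ∃ i ∈ s, D ≤ M ⊔ W i := by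
  obtain ⟨M, -, ⟨hMD, hdisj⟩, hmax⟩ := exists_maximal_ge_of_wellFoundedGT
    (fun M : Submodule K V => M ≤ D ∧ ∀ i ∈ s, Disjoint M (W i)) ⊥
    ⟨bot_le, fun _ _ => disjoint_bot_left⟩
  refine ⟨M, hMD, hdisj, ?_⟩
  by_contra! hcon
  obtain ⟨u, huD, hu⟩ := exists_mem_forall_notMem hs hcon
  have huM : u ∈ M := by
    refine hmax ⟨sup_le hMD ?_, fun i hi => ?_⟩ le_sup_left
      (Submodule.mem_sup_right (Submodule.mem_span_singleton_self u))
    · rwa [Submodule.span_singleton_le_iff_mem]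
    · have hu0 : u ≠ 0 := fun h => hu i hi (h ▸ Submodule.zero_mem _)
      rw [sup_comm]
      exact (hdisj i hi).disjoint_sup_left_of_disjoint_sup_right
        ((Submodule.disjoint_span_singleton' hu0).2 (hu i hi)).symm
  obtain ⟨i, hi⟩ := hne
  exact hu i hi (Submodule.mem_sup_left huM)

theorem exists_le_sup_eq_top_finrank {K V : Type*} [DivisionRing K] [AddCommGroup V] [Module K V]
    [FiniteDimensional K V] {S L : Submodule K V} (hSL : S ⊔ L = ⊤)
    (hdim : finrank K V < finrank K L + finrank K S) :
    ∃ L' ≤ L, S ⊔ L' = ⊤ ∧ finrank K L' + finrank K S = finrank K V + 1 := by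
  obtain ⟨C, hdisj, hsup⟩ := IsModularLattice.exists_disjoint_and_sup_eq (inf_le_right : S ⊓ L ≤ L)
  have hCL : C ≤ L := hsup ▸ le_sup_right
  have hcompl : IsCompl S C := by
    refine IsCompl.of_eq ?_ ?_
    · rw [← inf_eq_right.2 hCL, ← inf_assoc, hdisj.eq_bot]
    · rw [← sup_inf_self (a := S) (b := L), sup_assoc, hsup, hSL]
  have hC := Submodule.finrank_add_eq_of_isCompl hcompl
  obtain ⟨u, huL, huC⟩ : ∃ u ∈ L, u ∉ C := by
    refine SetLike.not_le_iff_exists.1 fun hLC => ?_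
    have := Submodule.finrank_mono hLC
    omega
  refine ⟨C ⊔ Submodule.span K {u}, sup_le hCL ?_, ?_, ?_⟩
  · rwa [Submodule.span_singleton_le_iff_mem]
  · rw [← sup_assoc, hcompl.sup_eq_top, top_sup_eq]
  · rw [Submodule.finrank_sup_span_singleton huC]
    omega

end Subspaces

section GeneralPosition

variable {V : Type*} [AddCommGroup V] [Module ℝ V]

theorem eventually_add_smul_notMem {B : Submodule ℝ V} {x y : V} (h : x ∉ B ∨ y ∉ B) :
    ∀ᶠ t : ℝ in 𝓝[>] 0, x + t • y ∉ B := by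
  by_cases hy : y ∈ B
  · have hx : x ∉ B := h.resolve_right (not_not.2 hy)
    exact Eventually.of_forall fun t => by rwa [B.add_mem_iff_left (B.smul_mem t hy)]
  · have hsub : {t : ℝ | x + t • y ∈ B}.Subsingleton := by
      intro a ha b hb
      have hdiff : (a - b) • y ∈ B := by
        rw [sub_smul, ← add_sub_add_left_eq_sub _ _ x]
        exact B.sub_mem ha hb
      by_contra hab
      exact hy ((B.smul_mem_iff (sub_ne_zero.2 hab)).1 hdiff)
    exact nhdsGT_le_nhdsNE 0 (nhdsNE_le_cofinite 0 hsub.finite.compl_mem_cofinite)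

theorem exists_mem_cone_forall_notMem {ι : Type*} {s : Set ι} (hs : s.Finite)
    {σ : PointedCone ℝ V} {B : ι → Submodule ℝ V}
    (h : ∀ i ∈ s, ¬ Submodule.span ℝ (σ : Set V) ≤ B i) : ∃ y ∈ σ, ∀ i ∈ s, y ∉ B i := by
  induction s, hs using Set.Finite.induction_on with
  | empty => exact ⟨0, σ.zero_mem, by simp⟩
  | @insert a s _ hs ih =>
    obtain ⟨y, hy, hys⟩ := ih fun i hi => h i (Set.mem_insert_of_mem a hi)
    obtain ⟨z, hz, hza⟩ : ∃ z ∈ σ, z ∉ B a := by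
      by_contra! hσ
      exact h a (Set.mem_insert a s) (Submodule.span_le.2 hσ)
    have hgen : ∀ᶠ t : ℝ in 𝓝[>] 0, ∀ i ∈ insert a s, y + t • z ∉ B i := by
      refine (eventually_all_finite (hs.insert a)).2 fun i hi => eventually_add_smul_notMem ?_
      exact hi.elim (fun hia => .inr (hia ▸ hza)) fun his => .inl (hys i his)
    obtain ⟨t, ht, ht0⟩ := (hgen.and self_mem_nhdsWithin).exists
    exact ⟨y + t • z, σ.add_mem hy (σ.smul_mem (le_of_lt ht0) hz), ht⟩

theorem exists_mem_cone_forall_notMem_of_eventually [TopologicalSpace V] [ContinuousAdd V]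
    [ContinuousSMul ℝ V] {ι : Type*} {s : Set ι} (hs : s.Finite) {σ : PointedCone ℝ V}
    {B : ι → Submodule ℝ V} (h : ∀ i ∈ s, ¬ Submodule.span ℝ (σ : Set V) ≤ B i) {ω : V}
    (hω : ω ∈ σ) {p : V → Prop} (hp : ∀ᶠ q in 𝓝 ω, p q) :
    ∃ q ∈ σ, p q ∧ ∀ i ∈ s, q ∉ B i := by
  obtain ⟨y, hyσ, hy⟩ := exists_mem_cone_forall_notMem hs h
  have hgen : ∀ᶠ t : ℝ in 𝓝[>] 0, ∀ i ∈ s, ω + t • y ∉ B i :=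
    (eventually_all_finite hs).2 fun i hi => eventually_add_smul_notMem (.inr (hy i hi))
  have hnear : Tendsto (fun t : ℝ => ω + t • y) (𝓝[>] 0) (𝓝 ω) := by
    have hcont : Continuous fun t : ℝ => ω + t • y := by fun_prop
    simpa using (hcont.tendsto 0).mono_left nhdsWithin_le_nhds
  obtain ⟨t, ⟨htB, htp⟩, ht⟩ := ((hgen.and (hnear.eventually hp)).and self_mem_nhdsWithin).exists
  exact ⟨ω + t • y, σ.add_mem hω (σ.smul_mem (le_of_lt ht) hyσ), htp, htB⟩

end GeneralPosition

theorem inner_neg_of_norm_add_smul_le {E : Type*} [NormedAddCommGroup E] [InnerProductSpace ℝ E]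
    {x l : E} {ε : ℝ} (hl : l ≠ 0) (hε : 0 < ε) (h : ‖x + ε • l‖ ≤ ‖x‖) : inner ℝ x l < 0 := by
  have hsq := pow_le_pow_left₀ (norm_nonneg _) h 2
  rw [norm_add_sq_real, inner_smul_right] at hsq
  have hpos : 0 < ‖ε • l‖ ^ 2 := by
    have := smul_ne_zero hε.ne' hl
    positivity
  refine neg_of_mul_neg_right (a := ε) ?_ hε.le
  linarith

/-- `x` lies in the relative interior of the cone `σ`. For a convex set this is equivalent to the
membership in the interior relative to the span, but it needs no topology on the space. -/
def IsRelInterior {V : Type*} [AddCommGroup V] [Module ℝ V] (σ : PointedCone ℝ V) (x : V) : Prop :=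
  ∀ u ∈ Submodule.span ℝ (σ : Set V), ∀ᶠ ε : ℝ in 𝓝[>] 0, x + ε • u ∈ σ

theorem IsRelInterior.mem {V : Type*} [AddCommGroup V] [Module ℝ V] {σ : PointedCone ℝ V} {x : V}
    (h : IsRelInterior σ x) : x ∈ σ := by
  simpa using (h 0 (Submodule.zero_mem _)).exists

/-- The properties of the set of cones of a `d`-dimensional balanced fan with positive weights that
govern the dimensions of its linear sections. Weights and lattice do not appear: the balancing
condition enters only through its consequence that no linear form vanishing on a cone `τ` of
codimension one can be negative on all the cones around `τ`, away from the span of `τ`. -/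
structure IsPositivelyBalanced {V : Type*} [AddCommGroup V] [Module ℝ V] [TopologicalSpace V]
    (𝓕 : Set (PointedCone ℝ V)) (d : ℕ) : Prop where
  finite : 𝓕.Finite
  isClosed : ∀ σ ∈ 𝓕, IsClosed (σ : Set V)
  exists_facet : ∀ σ ∈ 𝓕, ∃ ρ ∈ 𝓕, σ ≤ ρ ∧ finrank ℝ (Submodule.span ℝ (ρ : Set V)) = d
  exists_isRelInterior : ∀ σ ∈ 𝓕, ∀ x ∈ σ, ∃ τ ∈ 𝓕, IsRelInterior τ x
  balanced : ∀ τ ∈ 𝓕, finrank ℝ (Submodule.span ℝ (τ : Set V)) + 1 = d →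
    ∀ φ : Dual ℝ V, Submodule.span ℝ (τ : Set V) ≤ LinearMap.ker φ →
      ∃ σ ∈ 𝓕, τ ≤ σ ∧ ∃ v ∈ σ, v ∉ Submodule.span ℝ (τ : Set V) ∧ 0 ≤ φ v

section BalancedCollections

variable {V : Type*} [AddCommGroup V] [Module ℝ V] [TopologicalSpace V]
  {𝓕 : Set (PointedCone ℝ V)} {d : ℕ}

theorem IsPositivelyBalanced.isClosed_support (h : IsPositivelyBalanced 𝓕 d) :
    IsClosed {x | ∃ σ ∈ 𝓕, x ∈ σ} := by
  have hunion : {x | ∃ σ ∈ 𝓕, x ∈ σ} = ⋃ σ ∈ 𝓕, (σ : Set V) := by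
    ext x; simp
  rw [hunion]
  exact h.finite.isClosed_biUnion h.isClosed

theorem IsPositivelyBalanced.eventually_forall_mem (h : IsPositivelyBalanced 𝓕 d) (ω : V) :
    ∀ᶠ x in 𝓝 ω, ∀ σ ∈ 𝓕, x ∈ σ → ω ∈ σ := by
  refine (eventually_all_finite h.finite).2 fun σ hσ => ?_
  by_cases hω : ω ∈ σ
  · exact Eventually.of_forall fun _ _ => hω
  · filter_upwards [(h.isClosed σ hσ).isOpen_compl.mem_nhds hω] with x hx hxσ
    exact absurd hxσ hx

theorem IsPositivelyBalanced.finrank_le [FiniteDimensional ℝ V] (h : IsPositivelyBalanced 𝓕 d)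
    {σ : PointedCone ℝ V} (hσ : σ ∈ 𝓕) : finrank ℝ (Submodule.span ℝ (σ : Set V)) ≤ d := by
  obtain ⟨ρ, -, hσρ, rfl⟩ := h.exists_facet σ hσ
  exact Submodule.finrank_mono (Submodule.span_mono hσρ)

theorem IsPositivelyBalanced.exists_tangent_nonneg [FiniteDimensional ℝ V]
    (h : IsPositivelyBalanced 𝓕 d) {L : Submodule ℝ V}
    (hdim : finrank ℝ L + d = finrank ℝ V + 1) {τ : PointedCone ℝ V} (hτ : τ ∈ 𝓕)
    (hsup : Submodule.span ℝ (τ : Set V) ⊔ L = ⊤) {x : V} (hx : IsRelInterior τ x)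
    (φ : Dual ℝ V) :
    ∃ l ∈ L, l ≠ 0 ∧ 0 ≤ φ l ∧ ∃ σ ∈ 𝓕, ∀ᶠ ε : ℝ in 𝓝[>] 0, x + ε • l ∈ σ := by
  by_cases hbot : Submodule.span ℝ (τ : Set V) ⊓ L = ⊥
  · have hcompl : IsCompl L (Submodule.span ℝ (τ : Set V)) := (IsCompl.of_eq hbot hsup).symm
    have hrank := Submodule.finrank_add_eq_of_isCompl hcompl
    set π := L.projection _ hcompl
    obtain ⟨σ, hσ, hτσ, v, hvσ, hvτ, hφv⟩ := h.balanced τ hτ (by omega) (φ ∘ₗ π)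
      ((Submodule.ker_projection hcompl).ge.trans (LinearMap.ker_le_ker_comp π φ))
    have hvτ' : π v - v ∈ Submodule.span ℝ (τ : Set V) := by
      rw [← neg_sub]
      exact Submodule.neg_mem _ (Submodule.sub_projection_mem hcompl v)
    refine ⟨π v, Submodule.projection_apply_mem hcompl v, fun hπ0 => ?_, hφv, σ, hσ, ?_⟩
    · exact hvτ (by simpa [hπ0] using hvτ')
    · filter_upwards [hx _ hvτ', self_mem_nhdsWithin] with ε hε hε0
      convert σ.add_mem (hτσ hε) (σ.smul_mem (le_of_lt hε0) hvσ) using 1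
      module
  · obtain ⟨u, ⟨huτ, huL⟩, hu0⟩ := Submodule.exists_mem_ne_zero_of_ne_bot hbot
    rcases le_total 0 (φ u) with hφ | hφ
    · exact ⟨u, huL, hu0, hφ, τ, hτ, hx u huτ⟩
    · exact ⟨-u, L.neg_mem huL, neg_ne_zero.2 hu0, by simpa using hφ, τ, hτ,
        hx (-u) (Submodule.neg_mem _ huτ)⟩

end BalancedCollections

section LinearSections

variable {V : Type*} [NormedAddCommGroup V] [NormedSpace ℝ V] [FiniteDimensional ℝ V]
  {𝓕 : Set (PointedCone ℝ V)} {d : ℕ}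

theorem IsPositivelyBalanced.exists_dist_eq (h : IsPositivelyBalanced 𝓕 d)
    {L : Submodule ℝ V} (hdim : finrank ℝ L + d = finrank ℝ V + 1) {q ω : V} {r : ℝ}
    (hq : ∃ σ ∈ 𝓕, q ∈ σ) (hqr : dist q ω ≤ r)
    (hgen : ∀ τ ∈ 𝓕, Submodule.span ℝ (τ : Set V) ⊔ L ≠ ⊤ → q ∉ Submodule.span ℝ (τ : Set V) ⊔ L) :
    ∃ σ ∈ 𝓕, ∃ x ∈ σ, x - q ∈ L ∧ dist x ω = r := by
  have : ProperSpace V := FiniteDimensional.proper ℝ V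
  have hcompact : IsCompact (({x | ∃ σ ∈ 𝓕, x ∈ σ} ∩ {x | x - q ∈ L}) ∩ Metric.closedBall ω r) :=
    (isCompact_closedBall ω r).inter_left
      (h.isClosed_support.inter (L.closed_of_finiteDimensional.preimage (by fun_prop)))
  obtain ⟨x, ⟨⟨⟨σ, hσ, hxσ⟩, hxL⟩, hxr⟩, hmax⟩ := hcompact.exists_isMaxOn
    (f := fun x => ‖toEuclidean x‖) ⟨q, ⟨hq, by simp⟩, hqr⟩ (by fun_prop)
  refine ⟨σ, hσ, x, hxσ, hxL, (Metric.mem_closedBall.1 hxr).eq_of_not_lt fun hlt => ?_⟩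
  obtain ⟨τ, hτ, hxτ⟩ := h.exists_isRelInterior σ hσ x hxσ
  have hsup : Submodule.span ℝ (τ : Set V) ⊔ L = ⊤ := by
    refine by_contra fun hne => hgen τ hτ hne ?_
    rw [← sub_sub_cancel x q]
    exact Submodule.sub_mem _ (Submodule.mem_sup_left (Submodule.subset_span hxτ.mem))
      (Submodule.mem_sup_right hxL)
  obtain ⟨l, hlL, hl0, hφl, ρ, hρ, hl⟩ := h.exists_tangent_nonneg hdim hτ hsup hxτ
    (innerₗ _ (toEuclidean x) ∘ₗ toEuclidean.toLinearEquiv.toLinearMap)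
  have hball : ∀ᶠ ε : ℝ in 𝓝[>] 0, dist (x + ε • l) ω < r := by
    have hcont : ContinuousAt (fun ε : ℝ => dist (x + ε • l) ω) 0 := by fun_prop
    exact nhdsWithin_le_nhds (hcont.eventually_lt continuousAt_const (by simpa using hlt))
  obtain ⟨ε, ⟨hερ, hεr⟩, hε⟩ := ((hl.and hball).and self_mem_nhdsWithin).exists
  have hle : ‖toEuclidean (x + ε • l)‖ ≤ ‖toEuclidean x‖ := by
    refine hmax ⟨⟨⟨ρ, hρ, hερ⟩, ?_⟩, hεr.le⟩
    rw [Set.mem_ofPred_eq, add_sub_right_comm]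
    exact L.add_mem hxL (L.smul_mem ε hlL)
  rw [map_add, map_smul] at hle
  exact hφl.not_gt (inner_neg_of_norm_add_smul_le
    ((map_ne_zero_iff _ toEuclidean.injective).2 hl0) hε hle)

theorem IsPositivelyBalanced.exists_ne_of_span_sup_eq_top (h : IsPositivelyBalanced 𝓕 d)
    {L : Submodule ℝ V} (hdim : finrank ℝ L + d = finrank ℝ V + 1) {σ : PointedCone ℝ V}
    (hσ : σ ∈ 𝓕) (hsup : Submodule.span ℝ (σ : Set V) ⊔ L = ⊤) {ω : V} (hω : ω ∈ σ) :
    ∃ ρ ∈ 𝓕, ω ∈ ρ ∧ ∃ x ∈ ρ, x - ω ∈ L ∧ x ≠ ω := by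
  have : ProperSpace V := FiniteDimensional.proper ℝ V
  by_contra! hisol
  obtain ⟨r, hr, hball⟩ := Metric.nhds_basis_closedBall.eventually_iff.1 (h.eventually_forall_mem ω)
  have hcompact : IsCompact ({x | ∃ σ ∈ 𝓕, x ∈ σ} ∩ Metric.sphere ω r) :=
    (isCompact_sphere ω r).inter_left h.isClosed_support
  have hsphere : ∀ᶠ q in 𝓝 ω, ∀ x ∈ {x | ∃ σ ∈ 𝓕, x ∈ σ} ∩ Metric.sphere ω r, x - q ∉ L := by
    refine hcompact.eventually_forall_of_forall_eventually ?_
    rintro x ⟨⟨ρ, hρ, hxρ⟩, hxr⟩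
    have hxL : x - ω ∉ L := fun hxL => Metric.ne_of_mem_sphere hxr hr.ne'
      (hisol ρ hρ (hball (Metric.sphere_subset_closedBall hxr) ρ hρ hxρ) x hxρ hxL)
    have hcont : ContinuousAt (fun z : V × V => z.2 - z.1) (ω, x) := by fun_prop
    exact hcont.eventually (L.closed_of_finiteDimensional.isOpen_compl.mem_nhds hxL)
  obtain ⟨q, hqσ, ⟨hqsphere, hqr⟩, hgen⟩ := exists_mem_cone_forall_notMem_of_eventually
    (h.finite.sep fun τ => Submodule.span ℝ (τ : Set V) ⊔ L ≠ ⊤)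
    (fun τ hτ hle => hτ.2 (top_le_iff.1 (hsup ▸ sup_le hle le_sup_right))) hω
    (hsphere.and (Metric.closedBall_mem_nhds ω hr))
  obtain ⟨ρ, hρ, x, hxρ, hxL, hxr⟩ := h.exists_dist_eq hdim ⟨σ, hσ, hqσ⟩ hqr
    fun τ hτ hne => hgen τ ⟨hτ, hne⟩
  exact hqsphere x ⟨⟨ρ, hρ, hxρ⟩, hxr⟩ hxL

theorem IsPositivelyBalanced.finrank_add_le (h : IsPositivelyBalanced 𝓕 d) {L : Submodule ℝ V}
    {ω : V} (hω : ∃ σ ∈ 𝓕, ω ∈ σ) (hL : ∀ σ ∈ 𝓕, ω ∈ σ → ∀ x ∈ σ, x - ω ∈ L → x = ω) :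
    finrank ℝ L + d ≤ finrank ℝ V := by
  obtain ⟨C, -, hdisj, σ, ⟨hσ, hωσ⟩, hsup⟩ := exists_le_disjoint_le_sup
    (h.finite.sep fun σ => ω ∈ σ) hω (fun σ => Submodule.span ℝ (σ : Set V) ⊔ L) ⊤
  obtain ⟨ρ, hρ, hσρ, hρd⟩ := h.exists_facet σ hσ
  have hsup' : Submodule.span ℝ (ρ : Set V) ⊔ (C ⊔ L) = ⊤ := by
    refine top_le_iff.1 (hsup.trans ?_)
    rw [sup_left_comm]
    gcongr
  by_contra! hlt
  obtain ⟨L', hL', hρL', hdim⟩ := exists_le_sup_eq_top_finrank hsup' (by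
    have := Submodule.finrank_mono (le_sup_right : L ≤ C ⊔ L)
    omega)
  obtain ⟨τ, hτ, hωτ, x, hxτ, hxL', hxω⟩ :=
    h.exists_ne_of_span_sup_eq_top (hρd ▸ hdim) hρ hρL' (hσρ hωσ)
  obtain ⟨c, hc, l, hl, hcl⟩ := Submodule.mem_sup.1 (hL' hxL')
  have hc0 : c = 0 := by
    refine Submodule.disjoint_def.1 (hdisj τ ⟨hτ, hωτ⟩) c hc ?_
    rw [eq_sub_of_add_eq hcl]
    refine Submodule.sub_mem _ (Submodule.mem_sup_left ?_) (Submodule.mem_sup_right hl)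
    exact Submodule.sub_mem _ (Submodule.subset_span hxτ) (Submodule.subset_span hωτ)
  rw [hc0, zero_add] at hcl
  exact hxω (hL τ hτ hωτ x hxτ (hcl ▸ hl))

theorem IsPositivelyBalanced.exists_finrank_comap {E : Type*} [AddCommGroup E] [Module ℝ E]
    [FiniteDimensional ℝ E] (h : IsPositivelyBalanced 𝓕 d) (f : E →ₗ[ℝ] V) {ω : E}
    (hω : ∃ σ ∈ 𝓕, f ω ∈ σ) :
    ∃ σ ∈ 𝓕, f ω ∈ σ ∧ finrank ℝ E + d ≤
      finrank ℝ (Submodule.span ℝ (σ.comap f : Set E)) + finrank ℝ V := by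
  obtain ⟨M, -, hdisj, σ, ⟨hσ, hωσ⟩, hsup⟩ := exists_le_disjoint_le_sup
    (h.finite.sep fun σ => f ω ∈ σ) hω (fun σ => Submodule.span ℝ (σ.comap f : Set E)) ⊤
  have hinj : Disjoint M (LinearMap.ker f) := (hdisj σ ⟨hσ, hωσ⟩).mono_right fun x hx =>
    Submodule.subset_span (by simp [LinearMap.mem_ker.1 hx])
  have hM : finrank ℝ (M.map f) + d ≤ finrank ℝ V := by
    refine h.finrank_add_le hω fun τ hτ hωτ x hxτ hxM => ?_
    obtain ⟨m, hm, hmx⟩ := hxM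
    have hxm : x = f (m + ω) := by rw [map_add, hmx, sub_add_cancel]
    have hm0 : m = 0 := Submodule.disjoint_def.1 (hdisj τ ⟨hτ, hωτ⟩) m hm <| by
      rw [← add_sub_cancel_right m ω]
      exact Submodule.sub_mem _ (Submodule.subset_span (by simpa [hxm] using hxτ))
        (Submodule.subset_span hωτ)
    rw [hxm, hm0, zero_add]
  refine ⟨σ, hσ, hωσ, ?_⟩
  have hmap : finrank ℝ (M.map f) = finrank ℝ M := by
    rw [← LinearMap.range_domRestrict,
      LinearMap.finrank_range_of_inj (LinearMap.injective_domRestrict_iff.2 hinj)]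
  have hE := Submodule.finrank_mono hsup
  rw [finrank_top] at hE
  have hadd := Submodule.finrank_add_le_finrank_add_finrank M (Submodule.span ℝ (σ.comap f : Set E))
  omega

end LinearSections

section Products

variable {κ : Type*} {V : κ → Type*} [∀ i, AddCommGroup (V i)] [∀ i, Module ℝ (V i)]

/-- The product of a family of cones, as a cone in the product space. -/
abbrev piCone (σ : ∀ i, PointedCone ℝ (V i)) : PointedCone ℝ (∀ i, V i) :=
  Submodule.pi Set.univ σ

theorem mem_piCone {σ : ∀ i, PointedCone ℝ (V i)} {x : ∀ i, V i} :
    x ∈ piCone σ ↔ ∀ i, x i ∈ σ i := by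
  simp only [Submodule.mem_pi, Set.mem_univ, true_imp_iff]

theorem span_piCone [Finite κ] (σ : ∀ i, PointedCone ℝ (V i)) :
    Submodule.span ℝ (piCone σ : Set (∀ i, V i)) =
      Submodule.pi Set.univ fun i => Submodule.span ℝ (σ i : Set (V i)) := by
  classical
  refine le_antisymm (Submodule.span_le.2 fun x hx => ?_) ?_
  · exact Submodule.mem_pi.2 fun i _ => Submodule.subset_span (mem_piCone.1 hx i)
  · rw [← Submodule.iSup_map_single]
    refine iSup_le fun i => Submodule.map_le_iff_le_comap.2 (Submodule.span_le.2 fun y hy => ?_)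
    exact Submodule.subset_span (Submodule.le_comap_single_pi σ hy)

theorem finrank_submodule_pi_univ {K : Type*} [DivisionRing K] {V : κ → Type*}
    [∀ i, AddCommGroup (V i)] [∀ i, Module K (V i)] [∀ i, FiniteDimensional K (V i)] [Fintype κ]
    (p : ∀ i, Submodule K (V i)) :
    finrank K (Submodule.pi Set.univ p) = ∑ i, finrank K (p i) := by
  have hinj : Function.Injective (LinearMap.piMap fun i => (p i).subtype) :=
    Function.Injective.piMap fun i => (p i).subtype_injective
  have hrange : LinearMap.range (LinearMap.piMap fun i => (p i).subtype) =
      Submodule.pi Set.univ p := by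
    refine SetLike.coe_injective ?_
    simp [LinearMap.coe_range, LinearMap.coe_piMap, Set.range_piMap]
  rw [← hrange, LinearMap.finrank_range_of_inj hinj, finrank_pi_fintype]

theorem finrank_span_piCone [Fintype κ] [∀ i, FiniteDimensional ℝ (V i)]
    (σ : ∀ i, PointedCone ℝ (V i)) :
    finrank ℝ (Submodule.span ℝ (piCone σ : Set (∀ i, V i))) =
      ∑ i, finrank ℝ (Submodule.span ℝ (σ i : Set (V i))) := by
  rw [span_piCone, finrank_submodule_pi_univ]

theorem IsRelInterior.pi [Finite κ] {σ : ∀ i, PointedCone ℝ (V i)} {x : ∀ i, V i}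
    (h : ∀ i, IsRelInterior (σ i) (x i)) : IsRelInterior (piCone σ) x := by
  intro u hu
  rw [span_piCone] at hu
  filter_upwards [eventually_all.2 fun i => h i (u i) (Submodule.mem_pi.1 hu i trivial)] with ε hε
  exact mem_piCone.2 hε

section Balanced

variable [∀ i, TopologicalSpace (V i)] {𝓕 : ∀ i, Set (PointedCone ℝ (V i))} {d : κ → ℕ}

theorem exists_add_one_eq_of_sum_add_one_eq [Fintype κ] {a b : κ → ℕ} (hle : ∀ i, a i ≤ b i)
    (h : ∑ i, a i + 1 = ∑ i, b i) : ∃ i, a i + 1 = b i := by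
  obtain ⟨i, hi, hlt⟩ : ∃ i ∈ Finset.univ, a i < b i := Finset.exists_lt_of_sum_lt (by omega)
  have hsingle := Finset.single_le_sum (f := fun i => b i - a i) (fun _ _ => Nat.zero_le _) hi
  rw [Finset.sum_tsub_distrib _ fun i _ => hle i] at hsingle
  exact ⟨i, by omega⟩

theorem exists_piCone_forall_mem_nonneg [Fintype κ] [∀ i, FiniteDimensional ℝ (V i)]
    (h : ∀ i, IsPositivelyBalanced (𝓕 i) (d i)) {τ : ∀ i, PointedCone ℝ (V i)}
    (hτ : ∀ i, τ i ∈ 𝓕 i)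
    (hdim : finrank ℝ (Submodule.span ℝ (piCone τ : Set (∀ i, V i))) + 1 = ∑ i, d i)
    {φ : Dual ℝ (∀ i, V i)}
    (hφ : Submodule.span ℝ (piCone τ : Set (∀ i, V i)) ≤ LinearMap.ker φ) :
    ∃ σ : ∀ i, PointedCone ℝ (V i), (∀ i, σ i ∈ 𝓕 i) ∧ τ ≤ σ ∧ ∃ v ∈ piCone σ,
      v ∉ Submodule.span ℝ (piCone τ : Set (∀ i, V i)) ∧ 0 ≤ φ v := by
  classical
  rw [finrank_span_piCone] at hdim
  obtain ⟨i, hi⟩ := exists_add_one_eq_of_sum_add_one_eq (fun i => (h i).finrank_le (hτ i)) hdim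
  rw [span_piCone] at hφ ⊢
  obtain ⟨σ, hσ, hτσ, v, hvσ, hvτ, hφv⟩ := (h i).balanced (τ i) (hτ i) hi
    (φ ∘ₗ LinearMap.single ℝ V i) fun x hx => hφ (Submodule.le_comap_single_pi _ hx)
  have hle : τ ≤ Function.update τ i σ := le_update_self_iff.2 hτσ
  refine ⟨Function.update τ i σ, ?_, hle, Pi.single i v, mem_piCone.2 fun j => ?_, ?_, hφv⟩
  · exact (Function.forall_update_iff τ fun j ρ => ρ ∈ 𝓕 j).2 ⟨hσ, fun j _ => hτ j⟩
  · obtain rfl | hj := eq_or_ne j i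
    · simpa using hvσ
    · simp [hj]
  · exact fun hv => hvτ (by simpa using Submodule.mem_pi.1 hv i trivial)

theorem IsPositivelyBalanced.pi [Fintype κ] [∀ i, FiniteDimensional ℝ (V i)]
    (h : ∀ i, IsPositivelyBalanced (𝓕 i) (d i)) :
    IsPositivelyBalanced {C | ∃ σ, (∀ i, σ i ∈ 𝓕 i) ∧ C = piCone σ} (∑ i, d i) where
  finite := by
    refine ((Set.Finite.pi' fun i => (h i).finite).image piCone).subset ?_
    rintro _ ⟨σ, hσ, rfl⟩
    exact ⟨σ, hσ, rfl⟩
  isClosed := by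
    rintro _ ⟨σ, hσ, rfl⟩
    rw [Submodule.coe_pi]
    exact isClosed_set_pi fun i _ => (h i).isClosed _ (hσ i)
  exists_facet := by
    rintro _ ⟨σ, hσ, rfl⟩
    choose ρ hρ hle hd using fun i => (h i).exists_facet (σ i) (hσ i)
    refine ⟨piCone ρ, ⟨ρ, hρ, rfl⟩, Submodule.pi_mono fun i _ => hle i, ?_⟩
    simp only [finrank_span_piCone, hd]
  exists_isRelInterior := by
    rintro _ ⟨σ, hσ, rfl⟩ x hx
    choose τ hτ hxτ using fun i =>
      (h i).exists_isRelInterior (σ i) (hσ i) (x i) (mem_piCone.1 hx i)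
    exact ⟨piCone τ, ⟨τ, hτ, rfl⟩, .pi hxτ⟩
  balanced := by
    rintro _ ⟨τ, hτ, rfl⟩ hdim φ hφ
    obtain ⟨σ, hσ, hτσ, hv⟩ := exists_piCone_forall_mem_nonneg h hτ hdim hφ
    exact ⟨piCone σ, ⟨σ, hσ, rfl⟩, Submodule.pi_mono fun i _ => hτσ i, hv⟩

end Balanced

end Products

theorem exists_finrank_iInf_comap {κ : Type*} [Fintype κ] {V : κ → Type*}
    [∀ i, NormedAddCommGroup (V i)] [∀ i, NormedSpace ℝ (V i)] [∀ i, FiniteDimensional ℝ (V i)]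
    {𝓕 : ∀ i, Set (PointedCone ℝ (V i))} {d : κ → ℕ}
    (h : ∀ i, IsPositivelyBalanced (𝓕 i) (d i)) {E : Type*} [AddCommGroup E] [Module ℝ E]
    [FiniteDimensional ℝ E] (f : ∀ i, E →ₗ[ℝ] V i) {ω : E} (hω : ∀ i, ∃ σ ∈ 𝓕 i, f i ω ∈ σ) :
    ∃ σ : ∀ i, PointedCone ℝ (V i), (∀ i, σ i ∈ 𝓕 i ∧ f i ω ∈ σ i) ∧ finrank ℝ E + ∑ i, d i ≤
      finrank ℝ (Submodule.span ℝ ((⨅ i, (σ i).comap (f i) : PointedCone ℝ E) : Set E)) +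
        ∑ i, finrank ℝ (V i) := by
  choose ρ hρ hωρ using hω
  obtain ⟨_, ⟨σ, hσ, rfl⟩, hωσ, hdim⟩ := (IsPositivelyBalanced.pi h).exists_finrank_comap
    (LinearMap.pi f) ⟨piCone ρ, ⟨ρ, hρ, rfl⟩, mem_piCone.2 hωρ⟩
  have hcomap : (piCone σ).comap (LinearMap.pi f) = ⨅ i, (σ i).comap (f i) := by
    ext x
    simp
  rw [hcomap, finrank_pi_fintype] at hdim
  exact ⟨σ, fun i => ⟨hσ i, mem_piCone.1 hωσ i⟩, hdim⟩

section Fans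

variable {n : ℕ}

theorem IsRational.isClosed {σ : Cone n} (hσ : IsRational σ) :
    IsClosed (σ : Set (Fin n → ℝ)) := by
  obtain ⟨S, rfl⟩ := hσ
  exact isClosed_hull_image_finset intVec S

theorem coneDim_le_dim {F : Set (Cone n)} {σ : Cone n} (hσ : σ ∈ F) : coneDim σ ≤ dim F := by
  refine le_csSup ⟨n, ?_⟩ (Set.mem_image_of_mem coneDim hσ)
  rintro _ ⟨τ, -, rfl⟩
  exact (Submodule.finrank_le (linSpan τ)).trans_eq (finrank_fin_fun ℝ)

theorem mem_linkCone_iff {ω u : Fin n → ℝ} {σ : Cone n} {hω : ω ∈ σ} :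
    u ∈ linkCone ω σ hω ↔ ∀ᶠ ε : ℝ in 𝓝[>] 0, ω + ε • u ∈ σ := by
  rw [(nhdsGT_basis (0 : ℝ)).eventually_iff]
  simp only [Set.mem_Ioo, and_imp]
  rfl

theorem le_linkCone (ω : Fin n → ℝ) (σ : Cone n) (hω : ω ∈ σ) : σ ≤ linkCone ω σ hω :=
  fun _ hu => ⟨1, one_pos, fun _ hε _ => σ.add_mem hω (σ.smul_mem hε.le hu)⟩

theorem inf_lineal_linkCone_isFaceOf (x : Fin n → ℝ) (σ : Cone n) (hx : x ∈ σ) :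
    (σ ⊓ (linkCone x σ hx).lineal).IsFaceOf σ := by
  have hface := (PointedCone.IsFaceOf.refl σ).inf (PointedCone.IsFaceOf.lineal (linkCone x σ hx))
  rwa [inf_eq_left.2 (le_linkCone x σ hx)] at hface

theorem mem_lineal_linkCone_self (x : Fin n → ℝ) (σ : Cone n) (hx : x ∈ σ) :
    x ∈ (linkCone x σ hx).lineal := by
  refine PointedCone.mem_lineal.2 ⟨le_linkCone x σ hx hx, 1, one_pos, fun ε _ hε => ?_⟩
  have hscale : x + ε • -x = (1 - ε) • x := by module
  exact hscale ▸ σ.smul_mem (sub_nonneg.2 hε.le) hx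

theorem Fan.exists_isRelInterior (F : Fan n) {σ : Cone n} (hσ : σ ∈ F.cones) {x : Fin n → ℝ}
    (hx : x ∈ σ) : ∃ τ ∈ F.cones, IsRelInterior τ x := by
  obtain ⟨τ, -, ⟨hτ, hxτ⟩, hmin⟩ :=
    (F.cones.finite_toSet.sep fun ρ => x ∈ ρ).exists_le_minimal (a := σ) ⟨hσ, hx⟩
  have hface := inf_lineal_linkCone_isFaceOf x τ hxτ
  have hτle : τ ≤ τ ⊓ (linkCone x τ hxτ).lineal :=
    hmin ⟨F.face_mem τ hτ _ hface, hxτ, mem_lineal_linkCone_self x τ hxτ⟩ inf_le_left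
  have hspan : linSpan τ ≤ (linkCone x τ hxτ).lineal :=
    Submodule.span_le.2 fun u hu => (hτle hu).2
  exact ⟨τ, hτ, fun u hu => mem_linkCone_iff.1 (PointedCone.lineal_le _ (hspan hu))⟩

theorem IsPrimitiveGenerator.linSpan_le {τ σ : Cone n} {v : Fin n → ℤ} (hσ : IsRational σ)
    (hv : IsPrimitiveGenerator τ σ v) (hvτ : intVec v ∈ linSpan τ) : linSpan σ ≤ linSpan τ := by
  obtain ⟨S, rfl⟩ := hσ
  refine Submodule.span_le.2 ((SetLike.coe_subset_coe.2 (PointedCone.hull_le_span ℝ _)).trans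
    (SetLike.coe_subset_coe.2 (Submodule.span_le.2 ?_)))
  rintro _ ⟨z, hz, rfl⟩
  obtain ⟨m, hm⟩ := hv.2 z (Submodule.subset_span (Submodule.subset_span ⟨z, hz, rfl⟩))
  have hz' : intVec z = intVec (z - m • v) + (m : ℝ) • intVec v := by
    ext i
    simp [intVec]
  rw [hz']
  exact (linSpan τ).add_mem hm ((linSpan τ).smul_mem _ hvτ)

theorem WeightedFan.isPositivelyBalanced (F : WeightedFan n) (hpure : F.IsPure)
    (hbal : F.IsBalanced) (hpos : F.PositiveWeights) :
    IsPositivelyBalanced (F.cones : Set (Cone n)) (dim (F.cones : Set (Cone n))) where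
  finite := F.cones.finite_toSet
  isClosed σ hσ := (F.rational σ hσ).isClosed
  exists_facet σ hσ := by
    obtain ⟨ρ, hle, hρ⟩ := F.cones.exists_le_maximal hσ
    exact ⟨ρ, hρ.1, hle, hpure ρ hρ⟩
  exists_isRelInterior _ hσ _ hx := F.exists_isRelInterior hσ hx
  balanced := by
    classical
    intro τ hτ hdim φ hφ
    obtain ⟨v, hv, hsum⟩ := hbal τ hτ hdim
    obtain ⟨ρ, hτρ, hρ⟩ := F.cones.exists_le_maximal hτ
    obtain ⟨σ, hσ, hσφ⟩ : ∃ σ ∈ F.cones.filter (fun σ => F.IsFacet σ ∧ τ ≤ σ),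
        0 ≤ φ (F.weight σ • intVec (v σ)) := by
      refine Finset.exists_le_of_sum_le ⟨ρ, Finset.mem_filter.2 ⟨hρ.1, hρ, hτρ⟩⟩ ?_
      rw [Finset.sum_const_zero, ← map_sum]
      exact (LinearMap.mem_ker.1 (hφ hsum)).ge
    obtain ⟨hσF, hfacet, hτσ⟩ := Finset.mem_filter.1 hσ
    rw [map_smul, smul_eq_mul, mul_nonneg_iff_of_pos_left (hpos σ hfacet)] at hσφ
    refine ⟨σ, hσF, hτσ, intVec (v σ), (hv σ hfacet hτσ).1, fun hvτ => ?_, hσφ⟩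
    have hle : coneDim σ ≤ coneDim τ := Submodule.finrank_mono
      ((hv σ hfacet hτσ).linSpan_le (F.rational σ hσF) hvτ)
    rw [hpure σ hfacet, ← hdim] at hle
    exact Nat.not_succ_le_self _ hle

theorem coneDim_le_dim_link {F : Set (Cone n)} {ω : Fin n → ℝ} {σ : Cone n} (hσ : σ ∈ F)
    (hω : ω ∈ σ) : coneDim σ ≤ dim (link ω F) :=
  (Submodule.finrank_mono (Submodule.span_mono (le_linkCone ω σ hω))).trans
    (coneDim_le_dim ⟨σ, hσ, hω, rfl⟩)

end Fans

end TropFan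

theorem mainTheorem7 {n k : ℕ} (F : Fin k → TropFan.WeightedFan n)
    (hpure : ∀ i, (F i).IsPure) (hbal : ∀ i, (F i).IsBalanced)
    (hpos : ∀ i, (F i).PositiveWeights)
    (ω : Fin n → ℝ)
    (hω : ω ∈ TropFan.support
      (TropFan.commonRefinement fun i => ((F i).cones : Set (TropFan.Cone n)))) :
    (n : ℤ) - ∑ i, TropFan.codim ((F i).cones : Set (TropFan.Cone n)) ≤
      (TropFan.dim (TropFan.link ω
        (TropFan.commonRefinement fun i => ((F i).cones : Set (TropFan.Cone n)))) : ℤ) := by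
  obtain ⟨_, ⟨σ, hσ, rfl⟩, hωσ⟩ := hω
  obtain ⟨ρ, hρ, hdim⟩ := TropFan.exists_finrank_iInf_comap
    (fun i => (F i).isPositivelyBalanced (hpure i) (hbal i) (hpos i)) (fun _ => LinearMap.id)
    fun i => ⟨σ i, hσ i, (Submodule.mem_iInf _).1 hωσ i⟩
  have hlink : TropFan.coneDim (⨅ i, ρ i) ≤ TropFan.dim (TropFan.link ω
      (TropFan.commonRefinement fun i => ((F i).cones : Set (TropFan.Cone n)))) :=
    TropFan.coneDim_le_dim_link ⟨ρ, fun i => (hρ i).1, rfl⟩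
      ((Submodule.mem_iInf _).2 fun i => (hρ i).2)
  simp only [PointedCone.comap_id, finrank_fin_fun] at hdim
  have hsection := hdim.trans (Nat.add_le_add_right hlink _)
  simp only [TropFan.codim, Finset.sum_sub_distrib]
  zify at hsection
  linarith
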